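/- Fix an irrational $\alpha\in(0,1)$. Let $\mathcal M_n$ be the random graph with vertex set $[n]=\{1,\dots,n\}$ in which the pairs $\{i,j\}$, $i\neq j$, are edges independently, with probability $p_{|i-j|}$, where $p_\ell=1/\ell^{\alpha}$ for $\ell>1$ and $p_1=p_2$. A property holds "for every random enough $\mathcal M_n$" if its probability tends to $1$ as $n\to\infty$. All graphs $A,B,\dots$ are finite; $A\le^* B$ means that $A$ is an induced subgraph of $B$ (possibly equal to $B$), and $A<^*B$ that moreover $A\ne B$. For $A\le^* B$ and an equivalence relation $\lambda$ on $B\setminus A$ let $$\mathbf w_\lambda(A,B)=|(B\setminus A)/\lambda|-\alpha\,\mathbf e_\lambda(A,B),$$ where $\mathbf e_\lambda(A,B)$ is the number of edges of $B$ that are contained neither in $A$ nor in a single $\lambda$-class. Define: - $A<^*_c B$ if $A<^*B$ and $\mathbf w_\lambda(A,B)<0$ for every equivalence relation $\lambda$ on $B\setminus A$; - $A\le^*_i B$ if $A\le^* B$ and $A'<^*_c B$ whenever $A\le^*A'<^*B$; $A<^*_iB$ if moreover $A\neq B$; - $A\le^*_s B$ if $A\le^* B$ and there is no $A'$ with $A<^*_iA'\le^*B$;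 $A<^*_sB$ if moreover $A\ne B$; - $A<^*_aB$ if $A\le^*B$ and not $A<^*_sB$. For $\varepsilon>0$, $k\in\mathbb N$, a graph $M$ on $[n]$ and an injective $f:A\to[n]$, let $\mathcal G^{\varepsilon,k}_{A,B}(f,M)$ be the set of all sequences $\langle g_\ell:\ell<k\rangle$ of injective functions $g_\ell:B\to[n]$ extending $f$ such that - every edge $\{a,b\}$ of $B$ not contained in $A$ is mapped to an edge $\{g_\ell(a),g_\ell(b)\}$ of $M$; - $\operatorname{Rang}(g_{\ell_1})\cap\operatorname{Rang}(g_{\ell_2})=\operatorname{Rang}(f)$ for $\ell_1\ne\ell_2$; - $|g_\ell(x)-g_\ell(y)|\ge n^{\varepsilon}$ for all $\ell<k$, $x\in B\setminus A$, $y\in A$. **Theorem.** Let $A<^*B$ and suppose $A<^*_aB$. Then for every $\varepsilon>0$ there is $k\in\mathbb N$ such that, for every random enough $\mathcal M_n$, $$\mathcal G^{\varepsilon,k}_{A,B}(f,\mathcal M_n)=\emptyset\quad\text{for every injective } f:A\to[n].$$ -/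

import Mathlib

open MeasureTheory ProbabilityTheory Filter Topology

/-! ### The random graph on `n` points with edge probabilities decaying with distance -/

/-- The real number `p_d`: `p_1 = p_2` and `p_d = 1 / d ^ α` for `d > 1`. -/
noncomputable def edgeProbReal (α : ℝ) (d : ℕ) : ℝ :=
  if d ≤ 1 then 1 / (2 : ℝ) ^ α else 1 / (d : ℝ) ^ α

theorem edgeProbReal_mem {α : ℝ} (hα : 0 ≤ α) (d : ℕ) :
    edgeProbReal α d ∈ Set.Icc (0 : ℝ) 1 := by
  unfold edgeProbReal
  split_ifs with h
  · have : (1 : ℝ) ≤ (2 : ℝ) ^ α := Real.one_le_rpow (by norm_num) hα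
    exact ⟨by positivity, by rw [div_le_one (by linarith)]; exact this⟩
  · have hd : (1 : ℝ) ≤ d := by exact_mod_cast (by omega : 1 ≤ d)
    have : (1 : ℝ) ≤ (d : ℝ) ^ α := Real.one_le_rpow hd hα
    exact ⟨by positivity, by rw [div_le_one (by linarith)]; exact this⟩

/-- `p_d` as an element of the unit interval (for `α ≥ 0` the projection changes nothing). -/
noncomputable def edgeProb (α : ℝ) (d : ℕ) : unitInterval :=
  Set.projIcc (0 : ℝ) 1 zero_le_one (edgeProbReal α d)

theorem coe_edgeProb {α : ℝ} (hα : 0 ≤ α) (d : ℕ) :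
    (edgeProb α d : ℝ) = edgeProbReal α d := by
  rw [edgeProb, Set.projIcc_of_mem _ (edgeProbReal_mem hα d)]

/-- The pairs `i < j` of points; each unordered pair of distinct points occurs once. -/
abbrev PointPair (n : ℕ) : Type := {q : Fin n × Fin n // q.1 < q.2}

/-- The law of the edge indicators: independent, `{i, j}` is an edge with probability
`p_{|i - j|}`. -/
noncomputable def edgeLaw (α : ℝ) (n : ℕ) : Measure (PointPair n → Bool) :=
  Measure.pi fun q => bernoulliMeasure true false (edgeProb α ((q.1.2 : ℕ) - (q.1.1 : ℕ)))

/-- The graph on the `n` points whose edges are the pairs with indicator `true`. -/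
def drawnGraph {n : ℕ} (ω : PointPair n → Bool) : SimpleGraph (Fin n) :=
  SimpleGraph.fromRel fun i j => ∃ h : i < j, ω ⟨(i, j), h⟩ = true

/-- A property of graphs on `n` points holds for every random enough graph: its probability tends
to `1` as `n` tends to infinity. -/
def ForRandomEnough (α : ℝ) (P : (n : ℕ) → SimpleGraph (Fin n) → Prop) : Prop :=
  Tendsto (fun n : ℕ => edgeLaw α n {ω | P n (drawnGraph ω)}) atTop (𝓝 1)

/-! ### Weights and the relations between finite graphs

All finite graphs under consideration are induced subgraphs of one graph `G`; such a subgraph is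
given by its finite vertex set, and the submodel relation is inclusion of vertex sets. -/

section Weights

variable {V : Type*}

/-- The new vertices `B \ A`, as a type. -/
abbrev NewVertex (A B : Finset V) : Type _ := {x : V // x ∈ B ∧ x ∉ A}

/-- The number of classes of the equivalence relation `r` on `B \ A`. -/
noncomputable def classCount (A B : Finset V) (r : Setoid (NewVertex A B)) : ℕ :=
  Nat.card (Quotient r)

/-- The edges of `B` contained neither in `A` nor in a class of `r`. -/
def longEdges (G : SimpleGraph V) (A B : Finset V) (r : Setoid (NewVertex A B)) :
    Set (Sym2 V) :=
  {e | e ∈ G.edgeSet ∧ (∀ v ∈ e, v ∈ B) ∧ ¬ (∀ v ∈ e, v ∈ A) ∧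
    ∀ x : NewVertex A B, ¬ ∀ v ∈ e, ∃ h : v ∈ B ∧ v ∉ A, r ⟨v, h⟩ x}

/-- The weight: the number of classes minus `α` times the number of long edges. -/
noncomputable def weight (α : ℝ) (G : SimpleGraph V) (A B : Finset V)
    (r : Setoid (NewVertex A B)) : ℝ :=
  (classCount A B r : ℝ) - α * ((longEdges G A B r).ncard : ℝ)

/-- `A <*_c B`. -/
def StarC (α : ℝ) (G : SimpleGraph V) (A B : Finset V) : Prop :=
  A ⊂ B ∧ ∀ r : Setoid (NewVertex A B), weight α G A B r < 0

/-- `A ≤*_i B`. -/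
def StarILE (α : ℝ) (G : SimpleGraph V) (A B : Finset V) : Prop :=
  A ⊆ B ∧ ∀ A' : Finset V, A ⊆ A' → A' ⊂ B → StarC α G A' B

/-- `A <*_i B`. -/
def StarI (α : ℝ) (G : SimpleGraph V) (A B : Finset V) : Prop :=
  StarILE α G A B ∧ A ≠ B

/-- `A ≤*_s B`. -/
def StarSLE (α : ℝ) (G : SimpleGraph V) (A B : Finset V) : Prop :=
  A ⊆ B ∧ ¬ ∃ A' : Finset V, StarI α G A A' ∧ A' ⊆ B

/-- `A <*_s B`. -/
def StarS (α : ℝ) (G : SimpleGraph V) (A B : Finset V) : Prop :=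
  StarSLE α G A B ∧ A ≠ B

/-- `A <*_a B`. -/
def StarA (α : ℝ) (G : SimpleGraph V) (A B : Finset V) : Prop :=
  A ⊆ B ∧ ¬ StarS α G A B

/-- The sequences of `k` one-to-one extensions `g l : B → [n]` of `f : A → [n]` that map the edges
of `B` not contained in `A` to edges of `M`, are pairwise disjoint over `f`, and whose new points
are at distance at least `n ^ ε` from the range of `f`. -/
def farExtensions (ε : ℝ) (k : ℕ) (G : SimpleGraph V) (A B : Finset V) {n : ℕ}
    (f : A → Fin n) (M : SimpleGraph (Fin n)) : Set (Fin k → B → Fin n) :=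
  {g |
    (∀ l, Function.Injective (g l) ∧ ∀ (x : B) (hx : (x : V) ∈ A), g l x = f ⟨x, hx⟩) ∧
    (∀ l, ∀ x y : B, G.Adj x y → ¬ ((x : V) ∈ A ∧ (y : V) ∈ A) → M.Adj (g l x) (g l y)) ∧
    (∀ l₁ l₂, l₁ ≠ l₂ → Set.range (g l₁) ∩ Set.range (g l₂) = Set.range f) ∧
    (∀ l, ∀ x y : B, (x : V) ∉ A → (y : V) ∈ A →
      (n : ℝ) ^ ε ≤ |((g l x : ℕ) : ℝ) - ((g l y : ℕ) : ℝ)|)}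

end Weights

/-!
# A bound on the number of disjoint far extensions

Since `A <*_a B`, some `B'` with `A <*_i B' ⊆ B` exists, and extensions of `f` to `B` restrict to
extensions to `B'`. It suffices that the expected number of far copies of `B'` over a fixed
placement of `A` is at most `n ^ (-δ)` up to a power of `log n`, with `δ > 0`: copies that are
disjoint over `A` use different pairs of points, so the expected number of families of `k` such
copies is at most the `k`-th power of this, and for large `k` it beats the number of placements
(`edgeLaw_hasFarCopies_le`, `exists_tendsto_edgeLaw_hasFarCopies`).

The bound for one copy comes from a multiscale argument. Fix a placement `g` and contract the
closest pair of points, one of them outside `A`, again and again, as in Kruskal's algorithm. At the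
scale `d` of a contraction, the points identified so far form a map `π` which fixes `A`; the points
sent into `A` form an intermediate set `A'`, and the fibres of `π` over the others an equivalence
relation `λ` on `B' \ A'`. Raising the scale from `d` to `d'` multiplies the number of choices by
`(d' / d)` for each class and the probability by `(d' / d) ^ (-α)` for each edge not yet contracted,
in total by `(d' / d)` to the power `w_λ(A', B')`. As `A' <*_c B'`, this exponent is at most `-c`
(`StarI.card_newClasses_lt`, `StarI.exists_card_newClasses_add_le`), and nothing is merged with
`A` below the scale `n ^ ε`; this yields `δ = c * ε`.

To avoid counting placements scale by scale, the number of choices is carried by the products of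
inverse distances along the sequence of contractions. The pointwise inequality
`exp_neg_sum_log_pairDist_le` bounds the product of the edge probabilities by `n ^ (-c * ε)` times
the sum `removalSum` of these products over all possible sequences, and the sum of `removalSum` over
all placements is a power of `log n`, one harmonic sum for each removed point
(`sum_removalSum_le`).
-/

/-! ### Contracting closest pairs -/

section Contraction

open Finset

variable {W : Type*}

/-- The distance between the two ends of an unordered pair of vertices placed at `pos`. -/
noncomputable def pairDist {X : Type*} (pos : X → ℝ) : Sym2 X → ℝ :=
  Sym2.lift ⟨fun u v => |pos u - pos v|, fun u v => abs_sub_comm (pos u) (pos v)⟩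

@[simp]
theorem pairDist_mk {X : Type*} (pos : X → ℝ) (u v : X) :
    pairDist pos s(u, v) = |pos u - pos v| := rfl

theorem pairDist_map {X Y : Type*} (pos : Y → ℝ) (g : X → Y) (z : Sym2 X) :
    pairDist pos (z.map g) = pairDist (pos ∘ g) z := by
  induction z with | _ u v => rfl

/-- The new classes of a map `π : W → W` that fixes `A`: the fibres of `π` over points outside
`A`, each represented by the point it lies over. -/
def newClasses [Fintype W] [DecidableEq W] (A : Finset W) (π : W → W) : Finset W :=
  univ.image π \ A

/-- A pair is live if its ends are distinct and not both in `A`. -/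
def IsLive (A : Finset W) (z : Sym2 W) : Prop := ¬ z.IsDiag ∧ ∃ v ∈ z, v ∉ A

open Classical in
/-- The edges in `E` that are still live after every vertex `v` is identified with `π v`. -/
noncomputable def liveEdges (A : Finset W) (E : Finset (Sym2 W)) (π : W → W) :
    Finset (Sym2 W) :=
  E.filter fun e => IsLive A (e.map π)

theorem mem_liveEdges {A : Finset W} {E : Finset (Sym2 W)} {π : W → W} {e : Sym2 W} :
    e ∈ liveEdges A E π ↔ e ∈ E ∧ IsLive A (e.map π) := by
  classical exact mem_filter

/-- The sum, over all ways to remove `k` points outside `A` from `U` one after the other, each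
time choosing a remaining partner for the removed point, of the product of the inverse distances
between the removed points and their partners. Since `0⁻¹ = 0`, coinciding points contribute
nothing. -/
noncomputable def removalSum [DecidableEq W] (A : Finset W) (pos : W → ℝ) :
    ℕ → Finset W → ℝ
  | 0, _ => 1
  | k + 1, U => ∑ x ∈ U \ A, ∑ y ∈ U.erase x,
      |pos x - pos y|⁻¹ * removalSum A pos k (U.erase x)

theorem removalSum_nonneg [DecidableEq W] (A : Finset W) (pos : W → ℝ) (k : ℕ) (U : Finset W) :
    0 ≤ removalSum A pos k U := by
  induction k generalizing U with
  | zero => simp [removalSum]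
  | succ k ih =>
    exact sum_nonneg fun x _ => sum_nonneg fun y _ => mul_nonneg (by positivity) (ih _)

theorem inv_mul_removalSum_le [DecidableEq W] {A U : Finset W} (pos : W → ℝ) (k : ℕ) {x y : W}
    (hx : x ∈ U \ A) (hy : y ∈ U.erase x) :
    |pos x - pos y|⁻¹ * removalSum A pos k (U.erase x) ≤ removalSum A pos (k + 1) U := by
  have h0 : ∀ x y, 0 ≤ |pos x - pos y|⁻¹ * removalSum A pos k (U.erase x) := fun x y =>
    mul_nonneg (by positivity) (removalSum_nonneg _ _ _ _)
  exact (single_le_sum (f := fun y => |pos x - pos y|⁻¹ * removalSum A pos k (U.erase x))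
    (fun y _ => h0 x y) hy).trans
    (single_le_sum (f := fun x => ∑ y ∈ U.erase x,
      |pos x - pos y|⁻¹ * removalSum A pos k (U.erase x))
      (fun x _ => sum_nonneg fun y _ => h0 x y) hx)

/-- Moving `x` onto a point `y` at minimal distance from it at most doubles the distances. -/
theorem pairDist_map_update_le [DecidableEq W] {A : Finset W} {pos : W → ℝ} {x y : W} {U : Set W}
    (hmin : ∀ z ∈ U, z ≠ x → |pos x - pos y| ≤ |pos x - pos z|) {z : Sym2 W}
    (hU : ∀ v ∈ z, v ∈ U) (hz : IsLive A (z.map (Function.update id x y))) :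
    pairDist pos (z.map (Function.update id x y)) ≤ 2 * pairDist pos z := by
  induction z with | _ u v =>
  have hu := hU u (by simp)
  have hv := hU v (by simp)
  have hne := hz.1
  simp only [Sym2.map_mk, Sym2.mk_isDiag_iff, Function.update_apply, id] at hne
  simp only [Sym2.map_mk, pairDist_mk, Function.update_apply, id]
  have h1 := abs_nonneg (pos u - pos v)
  split_ifs at hne ⊢ with h h' h'
  · exact absurd rfl hne
  · subst h
    have := hmin v hv h'
    have := abs_sub_le (pos y) (pos u) (pos v)
    rw [abs_sub_comm (pos y) (pos u)] at this
    linarith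
  · subst h'
    have := hmin u hu h
    rw [abs_sub_comm (pos v) (pos u)] at this
    have := abs_sub_le (pos u) (pos v) (pos y)
    linarith
  · linarith

variable [Fintype W] [DecidableEq W]

theorem image_update_comp {π : W → W} {x y : W} (hy : y ∈ univ.image π) (hxy : y ≠ x) :
    univ.image (Function.update id x y ∘ π) = (univ.image π).erase x := by
  ext z
  simp only [mem_image, mem_univ, true_and, mem_erase, Function.comp, Function.update_apply, id]
  constructor
  · rintro ⟨w, rfl⟩
    split_ifs with h
    · exact ⟨hxy, by simpa using hy⟩
    · exact ⟨h, w, rfl⟩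
  · rintro ⟨hz, w, rfl⟩
    exact ⟨w, by simp [hz]⟩

/-- The pointwise multiscale inequality, by induction on the number `k` of classes outside `A`.
Live pairs are at distance at least `exp ρ`, new classes at distance at least `exp L` from `A`, and
all distances are measured in units of `exp ρ`: raising `ρ` to the logarithm `ρ'` of the next
contracted distance gains `(ρ' - ρ) * c` by `H`, and each contraction costs at most a factor `2`
in every distance. -/
theorem exp_neg_sum_log_pairDist_le {A : Finset W} {E : Finset (Sym2 W)} {α c : ℝ} (hα : 0 ≤ α)
    (hc : 0 ≤ c) (hA : A.Nonempty)
    (H : ∀ π : W → W, (∀ a ∈ A, π a = a) → (newClasses A π).Nonempty →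
      ((newClasses A π).card : ℝ) + c ≤ α * (liveEdges A E π).card)
    {pos : W → ℝ} (hpos : Function.Injective pos) (k : ℕ) :
    ∀ (π : W → W) (ρ L : ℝ), (∀ a ∈ A, π a = a) → (newClasses A π).card = k →
      (∀ x ∈ newClasses A π, ∀ y ∈ univ.image π, y ≠ x → ρ ≤ Real.log |pos x - pos y|) →
      (∀ x ∈ newClasses A π, ∀ a ∈ A, L ≤ Real.log |pos x - pos a|) →
      (k = 0 → L ≤ ρ) →
      Real.exp (-α * ∑ e ∈ liveEdges A E π, (Real.log (pairDist pos (e.map π)) - ρ)) ≤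
        Real.exp (α * E.card * Real.log 2 * k - c * (L - ρ) + ρ * k) *
          removalSum A pos k (univ.image π) := by
  have hlive : ∀ {π : W → W} {ρ : ℝ}, (∀ x ∈ newClasses A π, ∀ y ∈ univ.image π, y ≠ x →
      ρ ≤ Real.log |pos x - pos y|) → ∀ e ∈ liveEdges A E π,
      ρ ≤ Real.log (pairDist pos (e.map π)) := by
    intro π ρ h e he
    have he := (mem_liveEdges.1 he).2
    induction e with | _ u v =>
    obtain ⟨hne, w, hw, hwA⟩ := he
    simp only [Sym2.map_mk, Sym2.mk_isDiag_iff] at hne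
    simp only [Sym2.map_mk, Sym2.mem_iff] at hw
    simp only [Sym2.map_mk, pairDist_mk]
    rcases hw with rfl | rfl
    · exact h _ (by simp [newClasses, hwA]) _ (by simp) (Ne.symm hne)
    · rw [abs_sub_comm]
      exact h _ (by simp [newClasses, hwA]) _ (by simp) hne
  induction k with
  | zero =>
    intro π ρ L _ hk _ _ hL
    have hnone : liveEdges A E π = ∅ := by
      refine eq_empty_of_forall_notMem fun e he => ?_
      obtain ⟨-, v, hv, hvA⟩ := (mem_liveEdges.1 he).2
      obtain ⟨w, -, rfl⟩ := Sym2.mem_map.1 hv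
      have : π w ∈ newClasses A π := by simp [newClasses, hvA]
      simp [card_eq_zero.1 hk] at this
    simp only [hnone, sum_empty, mul_zero, Real.exp_zero, removalSum, mul_one]
    exact Real.one_le_exp (by have := mul_nonneg hc (sub_nonneg.2 (hL rfl)); push_cast; linarith)
  | succ k ih =>
    intro π ρ L hπ hk hρ hL _
    have hne : (newClasses A π).Nonempty := card_pos.1 (by omega)
    -- a pair of representatives at minimal distance, the first of them outside `A`
    let P := (newClasses A π ×ˢ univ.image π).filter fun q => q.2 ≠ q.1
    have hP : P.Nonempty := by
      obtain ⟨x, hx⟩ := hne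
      obtain ⟨a, ha⟩ := hA
      refine ⟨(x, a), mem_filter.2 ⟨mem_product.2 ⟨hx, ?_⟩, ?_⟩⟩
      · exact mem_image.2 ⟨a, mem_univ _, hπ a ha⟩
      · exact fun h => (mem_sdiff.1 hx).2 ((show a = x from h) ▸ ha)
    obtain ⟨⟨x, y⟩, hxyP, hmin⟩ := exists_min_image P (fun q => |pos q.1 - pos q.2|) hP
    obtain ⟨hxy, hyx⟩ := mem_filter.1 hxyP
    obtain ⟨hx, hy⟩ := mem_product.1 hxy
    dsimp only at hyx hx hy
    replace hmin : ∀ u ∈ newClasses A π, ∀ v ∈ univ.image π, v ≠ u →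
        |pos x - pos y| ≤ |pos u - pos v| := fun u hu v hv h =>
      hmin (u, v) (mem_filter.2 ⟨mem_product.2 ⟨hu, hv⟩, h⟩)
    have hdpos : 0 < |pos x - pos y| :=
      abs_pos.2 (sub_ne_zero.2 fun h => hyx (hpos h).symm)
    have hxA : x ∉ A := (mem_sdiff.1 hx).2
    obtain ⟨ρ', hρ'⟩ : ∃ r, r = Real.log |pos x - pos y| := ⟨_, rfl⟩
    have hρρ' : ρ ≤ ρ' := hρ'.symm ▸ hρ x hx y hy hyx
    let π' := Function.update id x y ∘ π
    have himg : univ.image π' = (univ.image π).erase x := image_update_comp hy hyx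
    have hnew : newClasses A π' = (newClasses A π).erase x := by
      rw [newClasses, himg, newClasses, erase_sdiff_comm]
    have hπ' : ∀ a ∈ A, π' a = a := fun a ha => by
      simp only [π', Function.comp, hπ a ha, Function.update_apply, id]
      rw [if_neg (fun h : a = x => hxA (h ▸ ha))]
    have hk' : (newClasses A π').card = k := by rw [hnew, card_erase_of_mem hx]; omega
    have hmin' : ∀ u ∈ newClasses A π, ∀ v ∈ univ.image π, v ≠ u →
        ρ' ≤ Real.log |pos u - pos v| := fun u hu v hv h =>
      hρ' ▸ Real.log_le_log hdpos (hmin u hu v hv h)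
    -- the threshold for the contracted system; it drops out once a point is merged into `A`
    obtain ⟨L', hL', hL'k, hLL'⟩ : ∃ L', (∀ u ∈ newClasses A π', ∀ a ∈ A,
        L' ≤ Real.log |pos u - pos a|) ∧ (k = 0 → L' ≤ ρ') ∧ L ≤ L' := by
      by_cases hyA : y ∈ A
      · refine ⟨ρ', fun u hu a ha => ?_, fun _ => le_rfl, hρ'.symm ▸ hL x hx y hyA⟩
        rw [hnew] at hu
        have hu := mem_of_mem_erase hu
        exact hmin' u hu a (mem_image.2 ⟨a, mem_univ _, hπ a ha⟩)
          (fun h => (mem_sdiff.1 hu).2 (h ▸ ha))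
      · refine ⟨L, fun u hu => hL u (mem_of_mem_erase (hnew ▸ hu)), fun hk0 => ?_, le_rfl⟩
        have : y ∈ newClasses A π' := by
          rw [hnew]; exact mem_erase.2 ⟨hyx, mem_sdiff.2 ⟨hy, hyA⟩⟩
        rw [card_eq_zero.1 (hk'.trans hk0)] at this
        simp at this
    have hih := ih π' ρ' L' hπ' hk'
      (fun u hu v hv => hmin' u (mem_of_mem_erase (hnew ▸ hu)) v
        (mem_of_mem_erase (himg ▸ hv))) hL' hL'k
    -- comparison of the two sums over live edges
    have hsub : liveEdges A E π' ⊆ liveEdges A E π := by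
      intro e he
      obtain ⟨heE, hlv⟩ := mem_liveEdges.1 he
      refine mem_liveEdges.2 ⟨heE, ?_⟩
      rw [← Sym2.map_map] at hlv
      generalize e.map π = z at hlv
      induction z with | _ u v =>
      obtain ⟨h1, w, hw, hwA⟩ := hlv
      simp only [Sym2.map_mk, Sym2.mk_isDiag_iff] at h1
      simp only [Sym2.map_mk, Sym2.mem_iff] at hw
      refine ⟨fun h => h1 (by rw [Sym2.mk_isDiag_iff] at h; rw [h]), ?_⟩
      by_contra hcon
      push Not at hcon
      have hu := hcon u (by simp)
      have hv := hcon v (by simp)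
      have e1 : Function.update id x y u = u := by
        rw [Function.update_apply, if_neg (fun h : u = x => hxA (h ▸ hu)), id]
      have e2 : Function.update id x y v = v := by
        rw [Function.update_apply, if_neg (fun h : v = x => hxA (h ▸ hv)), id]
      rw [e1, e2] at hw
      rcases hw with rfl | rfl <;> contradiction
    have hsum : ∑ e ∈ liveEdges A E π', (Real.log (pairDist pos (e.map π')) - ρ')
          - E.card * Real.log 2 ≤
        ∑ e ∈ liveEdges A E π, (Real.log (pairDist pos (e.map π)) - ρ') := by
      have h1 : ∑ e ∈ liveEdges A E π', (Real.log (pairDist pos (e.map π)) - ρ') ≤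
          ∑ e ∈ liveEdges A E π, (Real.log (pairDist pos (e.map π)) - ρ') :=
        sum_le_sum_of_subset_of_nonneg hsub fun e he _ => sub_nonneg.2 (hlive hmin' e he)
      have h2 : ∑ e ∈ liveEdges A E π', (Real.log (pairDist pos (e.map π')) - ρ') ≤
          ∑ e ∈ liveEdges A E π',
            ((Real.log (pairDist pos (e.map π)) - ρ') + Real.log 2) := by
        refine sum_le_sum fun e he => ?_
        have hlv := (mem_liveEdges.1 he).2
        have hd : pairDist pos (e.map π') ≤ 2 * pairDist pos (e.map π) := by
          have hmap : e.map π' = (e.map π).map (Function.update id x y) := by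
            rw [Sym2.map_map]
          rw [hmap] at hlv ⊢
          refine pairDist_map_update_le (U := {v | v ∈ univ.image π})
            (fun z hz hzx => hmin x hx z hz hzx) ?_ hlv
          intro v hv
          obtain ⟨w, -, rfl⟩ := Sym2.mem_map.1 hv
          simp
        have hp : 0 < pairDist pos (e.map π') := by
          generalize e.map π' = z at hlv
          induction z with | _ u v =>
          exact abs_pos.2 (sub_ne_zero.2 fun h => hlv.1 (by simpa using hpos h))
        have := Real.log_le_log hp hd
        rw [Real.log_mul two_ne_zero (by linarith)] at this
        linarith
      rw [sum_add_distrib, sum_const, nsmul_eq_mul] at h2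
      have h3 : ((liveEdges A E π').card : ℝ) * Real.log 2 ≤ E.card * Real.log 2 := by
        gcongr
        exact fun e he => (mem_liveEdges.1 he).1
      linarith
    have hshift : ∑ e ∈ liveEdges A E π, (Real.log (pairDist pos (e.map π)) - ρ) =
        ∑ e ∈ liveEdges A E π, (Real.log (pairDist pos (e.map π)) - ρ') +
          (liveEdges A E π).card * (ρ' - ρ) := by
      rw [← nsmul_eq_mul, ← sum_const, ← sum_add_distrib]
      exact sum_congr rfl fun e _ => by ring
    have hweight := mul_le_mul_of_nonneg_right (H π hπ hne) (sub_nonneg.2 hρρ')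
    rw [hk] at hweight
    push_cast at hweight
    have hcL := mul_le_mul_of_nonneg_left hLL' hc
    have hsumα := mul_le_mul_of_nonneg_left hsum hα
    have hstep := inv_mul_removalSum_le (A := A) (U := univ.image π) pos k hx
      (mem_erase.2 ⟨hyx, hy⟩)
    rw [← himg, ← Real.exp_log hdpos, ← hρ', ← Real.exp_neg] at hstep
    calc Real.exp (-α * ∑ e ∈ liveEdges A E π, (Real.log (pairDist pos (e.map π)) - ρ))
        ≤ Real.exp (α * E.card * Real.log 2 - (k + 1 + c) * (ρ' - ρ)) * Real.exp
            (-α * ∑ e ∈ liveEdges A E π', (Real.log (pairDist pos (e.map π')) - ρ')) := by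
          rw [← Real.exp_add, hshift]
          apply Real.exp_le_exp.2
          linarith
      _ ≤ Real.exp (α * E.card * Real.log 2 - (k + 1 + c) * (ρ' - ρ)) *
            (Real.exp (α * E.card * Real.log 2 * k - c * (L' - ρ') + ρ' * k) *
              removalSum A pos k (univ.image π')) := by gcongr
      _ = Real.exp (α * E.card * Real.log 2 * (k + 1) - c * (L' - ρ) + ρ * (k + 1)) *
            (Real.exp (-ρ') * removalSum A pos k (univ.image π')) := by
          rw [← mul_assoc, ← mul_assoc, ← Real.exp_add, ← Real.exp_add]
          congr 2
          ring
      _ ≤ Real.exp (α * E.card * Real.log 2 * (k + 1) - c * (L - ρ) + ρ * (k + 1)) *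
            removalSum A pos (k + 1) (univ.image π) := by
          refine mul_le_mul (Real.exp_le_exp.2 (by linarith)) hstep
            (mul_nonneg (Real.exp_pos _).le (removalSum_nonneg _ _ _ _)) (Real.exp_pos _).le
      _ = _ := by push_cast; rfl

end Contraction

/-! ### Summing over the placements -/

section Summation

open Finset

theorem sum_abs_sub_inv_le (n : ℕ) (u : Fin n) :
    ∑ t : Fin n, |((t : ℕ) : ℝ) - ((u : ℕ) : ℝ)|⁻¹ ≤ 2 * (1 + Real.log n) := by
  obtain ⟨u, hu⟩ := u
  rw [Fin.sum_univ_eq_sum_range (fun t : ℕ => |(t : ℝ) - (u : ℝ)|⁻¹) n,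
    ← sum_range_add_sum_Ico _ (show u + 1 ≤ n by omega)]
  have hharm : ∀ m ≤ n, ∑ i ∈ range m, ((i + 1 : ℕ) : ℝ)⁻¹ ≤ 1 + Real.log n := by
    intro m hm
    have h := harmonic_le_one_add_log n
    simp only [harmonic, Rat.cast_sum, Rat.cast_inv, Rat.cast_natCast] at h
    refine le_trans (sum_le_sum_of_subset_of_nonneg ?_ fun i _ _ => by positivity) h
    simpa using hm
  have h1 : ∑ t ∈ range (u + 1), |(t : ℝ) - u|⁻¹ = ∑ i ∈ range u, ((i + 1 : ℕ) : ℝ)⁻¹ := by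
    rw [← sum_range_reflect, sum_range_succ']
    simp only [Nat.add_sub_cancel, Nat.sub_zero, sub_self, abs_zero, inv_zero, add_zero]
    refine sum_congr rfl fun i hi => ?_
    rw [Nat.cast_sub (by simp at hi; omega), sub_sub_cancel_left, abs_neg, Nat.abs_cast]
  have h2 : ∑ t ∈ Ico (u + 1) n, |(t : ℝ) - u|⁻¹ =
      ∑ i ∈ range (n - (u + 1)), ((i + 1 : ℕ) : ℝ)⁻¹ := by
    rw [sum_Ico_eq_sum_range]
    refine sum_congr rfl fun i _ => ?_
    have : ((u + 1 + i : ℕ) : ℝ) - u = ((i + 1 : ℕ) : ℝ) := by push_cast; ring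
    rw [this, Nat.abs_cast]
  rw [h1, h2]
  linarith [hharm u (by omega), hharm (n - (u + 1)) (by omega)]

variable {W : Type*} [DecidableEq W]

theorem removalSum_congr (A : Finset W) {pos pos' : W → ℝ} (k : ℕ) :
    ∀ {U : Finset W}, (∀ v ∈ U, pos v = pos' v) →
      removalSum A pos k U = removalSum A pos' k U := by
  induction k with
  | zero => intro U _; rfl
  | succ k ih =>
    intro U h
    refine sum_congr rfl fun x hx => sum_congr rfl fun y hy => ?_
    rw [h x (mem_sdiff.1 hx).1, h y (mem_of_mem_erase hy),
      ih fun v hv => h v (mem_of_mem_erase hv)]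

variable [Fintype W]

/-- The maps that agree with `h` off `S`. -/
def extensionsOff {X : Type*} [Fintype X] [DecidableEq X] (S : Finset W) (h : W → X) :
    Finset (W → X) :=
  univ.filter fun g => ∀ v ∉ S, g v = h v

theorem sum_extensionsOff {X : Type*} [Fintype X] [DecidableEq X] {S : Finset W} (h : W → X)
    {x : W} (hx : x ∈ S) (F : (W → X) → ℝ) :
    ∑ g ∈ extensionsOff S h, F g =
      ∑ g ∈ extensionsOff (S.erase x) h, ∑ t, F (Function.update g x t) := by
  rw [← sum_product']
  refine sum_bij' (fun g _ => (Function.update g x (h x), g x))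
    (fun q _ => Function.update q.1 x q.2) ?_ ?_ ?_ ?_ ?_
  · intro g hg
    simp only [extensionsOff, mem_filter, mem_univ, true_and, mem_product, and_true, mem_erase,
      not_and] at hg ⊢
    intro v hv
    by_cases hvx : v = x
    · simp [hvx]
    · rw [Function.update_of_ne hvx]
      exact hg v (hv hvx)
  · rintro ⟨g, t⟩ hg
    simp only [extensionsOff, mem_filter, mem_univ, true_and, mem_product, and_true, mem_erase,
      not_and] at hg ⊢
    intro v hv
    have hvx : v ≠ x := fun e => hv (e ▸ hx)
    rw [Function.update_of_ne hvx]
    exact hg v fun _ => hv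
  · intro g _
    simp
  · rintro ⟨g, t⟩ hg
    simp only [extensionsOff, mem_filter, mem_univ, true_and, mem_product, and_true, mem_erase,
      not_and] at hg
    have : h x = g x := (hg x fun e => absurd rfl e).symm
    simp [this]
  · intro g _
    simp

/-- Summing the positions of the removed points, in the order in which they are removed, costs
one harmonic sum for each of them. -/
theorem sum_removalSum_le {n : ℕ} (A : Finset W) (h : W → Fin n) (k : ℕ) :
    ∀ U : Finset W, (U \ A).card = k →
      ∑ g ∈ extensionsOff (U \ A) h, removalSum A (fun v => ((g v : ℕ) : ℝ)) k U ≤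
        ((Fintype.card W : ℝ) ^ 2 * (2 * (1 + Real.log n))) ^ k := by
  have hD : 0 ≤ 2 * (1 + Real.log n) := by
    have := Real.log_natCast_nonneg n
    positivity
  induction k with
  | zero =>
    intro U hU
    have h1 : extensionsOff (U \ A) h ⊆ {h} := by
      intro g hg
      rw [card_eq_zero.1 hU] at hg
      simp only [extensionsOff, mem_filter, mem_univ, true_and] at hg
      exact mem_singleton.2 (funext fun v => hg v (notMem_empty v))
    simpa [removalSum] using card_le_card h1
  | succ k ih =>
    intro U hU
    simp only [removalSum]
    rw [sum_comm]
    have hx : ∀ x ∈ U \ A, ∑ g ∈ extensionsOff (U \ A) h, ∑ y ∈ U.erase x,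
        |((g x : ℕ) : ℝ) - ((g y : ℕ) : ℝ)|⁻¹ *
          removalSum A (fun v => ((g v : ℕ) : ℝ)) k (U.erase x) ≤
        Fintype.card W * (2 * (1 + Real.log n) *
          ((Fintype.card W : ℝ) ^ 2 * (2 * (1 + Real.log n))) ^ k) := by
      intro x hx
      have her : (U.erase x) \ A = (U \ A).erase x := by rw [erase_sdiff_comm]
      rw [sum_comm, ← nsmul_eq_mul]
      refine (sum_le_card_nsmul _ _ _ fun y hy => ?_).trans
        (nsmul_le_nsmul_left (by positivity) (card_le_univ _))
      rw [sum_extensionsOff h hx]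
      have hin : ∀ g ∈ extensionsOff ((U \ A).erase x) h,
          ∑ t : Fin n, |((Function.update g x t x : ℕ) : ℝ) -
              ((Function.update g x t y : ℕ) : ℝ)|⁻¹ *
            removalSum A (fun v => ((Function.update g x t v : ℕ) : ℝ)) k (U.erase x) ≤
          2 * (1 + Real.log n) * removalSum A (fun v => ((g v : ℕ) : ℝ)) k (U.erase x) := by
        intro g _
        have hc : ∀ t : Fin n,
            removalSum A (fun v => ((Function.update g x t v : ℕ) : ℝ)) k (U.erase x) =
              removalSum A (fun v => ((g v : ℕ) : ℝ)) k (U.erase x) := fun t =>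
          removalSum_congr A k fun v hv => by rw [Function.update_of_ne (ne_of_mem_erase hv)]
        simp only [hc, Function.update_self, Function.update_of_ne (ne_of_mem_erase hy)]
        rw [← sum_mul]
        exact mul_le_mul_of_nonneg_right (sum_abs_sub_inv_le n (g y)) (removalSum_nonneg _ _ _ _)
      refine (sum_le_sum hin).trans ?_
      rw [← mul_sum, ← her]
      refine mul_le_mul_of_nonneg_left (ih _ ?_) hD
      rw [her, card_erase_of_mem hx, hU, Nat.add_sub_cancel]
    refine (sum_le_card_nsmul _ _ _ hx).trans
      ((nsmul_le_nsmul_left (by positivity) (card_le_univ _)).trans (le_of_eq ?_))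
    rw [nsmul_eq_mul]
    ring

open Classical in
/-- The injective placements that agree with `h` on `A` and keep the points outside `A` at
distance at least `n ^ ε` from those in `A`. -/
noncomputable def farPlacements (ε : ℝ) (A : Finset W) {n : ℕ} (h : W → Fin n) :
    Finset (W → Fin n) :=
  (extensionsOff (univ \ A) h).filter fun g => Function.Injective g ∧
    ∀ x ∉ A, ∀ a ∈ A, (n : ℝ) ^ ε ≤ |((g x : ℕ) : ℝ) - ((g a : ℕ) : ℝ)|

theorem mem_farPlacements {ε : ℝ} {A : Finset W} {n : ℕ} {h g : W → Fin n} :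
    g ∈ farPlacements ε A h ↔ (∀ a ∈ A, g a = h a) ∧ Function.Injective g ∧
      ∀ x ∉ A, ∀ a ∈ A, (n : ℝ) ^ ε ≤ |((g x : ℕ) : ℝ) - ((g a : ℕ) : ℝ)| := by
  classical simp [farPlacements, extensionsOff]

/-- The expected number of copies over a fixed placement of `A` is at most a power of `log n`
times `n ^ (-(c * ε))`. -/
theorem sum_prod_pairDist_rpow_le {A : Finset W} {E : Finset (Sym2 W)} {α c ε : ℝ} (hα : 0 ≤ α)
    (hc : 0 ≤ c) (hA : A.Nonempty) (hAne : (univ \ A).Nonempty) (hE : ∀ e ∈ E, IsLive A e)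
    (H : ∀ π : W → W, (∀ a ∈ A, π a = a) → (newClasses A π).Nonempty →
      ((newClasses A π).card : ℝ) + c ≤ α * (liveEdges A E π).card)
    {n : ℕ} (hn : 0 < n) (h : W → Fin n) :
    ∑ g ∈ farPlacements ε A h,
        ∏ e ∈ E, pairDist (fun i : Fin n => ((i : ℕ) : ℝ)) (e.map g) ^ (-α) ≤
      Real.exp (α * E.card * Real.log 2 * (univ \ A).card) * (n : ℝ) ^ (-(c * ε)) *
        ((Fintype.card W : ℝ) ^ 2 * (2 * (1 + Real.log n))) ^ (univ \ A).card := by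
  have hn' : (0 : ℝ) < n := by exact_mod_cast hn
  have himg : (univ : Finset W).image id = univ := image_id
  have hpt : ∀ g ∈ farPlacements ε A h,
      ∏ e ∈ E, pairDist (fun i : Fin n => ((i : ℕ) : ℝ)) (e.map g) ^ (-α) ≤
        Real.exp (α * E.card * Real.log 2 * (univ \ A).card) * (n : ℝ) ^ (-(c * ε)) *
          removalSum A (fun v => ((g v : ℕ) : ℝ)) (univ \ A).card univ := by
    intro g hg
    obtain ⟨-, hinj, hfar⟩ := mem_farPlacements.1 hg
    have hpos : Function.Injective fun v => ((g v : ℕ) : ℝ) := fun u v huv =>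
      hinj (Fin.ext (Nat.cast_injective (R := ℝ) huv))
    have hone : ∀ u v, u ≠ v → 1 ≤ |((g u : ℕ) : ℝ) - ((g v : ℕ) : ℝ)| := by
      intro u v huv
      have h1 : ((g u : ℕ) : ℤ) - ((g v : ℕ) : ℤ) ≠ 0 := fun h0 =>
        huv (hinj (Fin.ext (by omega)))
      have h2 := Int.one_le_abs h1
      exact_mod_cast h2
    have hmain := exp_neg_sum_log_pairDist_le (pos := fun v => ((g v : ℕ) : ℝ)) hα hc hA H hpos
      (univ \ A).card id 0 (ε * Real.log n) (fun _ _ => rfl) (by rw [newClasses, himg])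
      (fun x _ y _ hyx => Real.log_nonneg (hone x y hyx.symm))
      (fun x hx a ha => by
        rw [← Real.log_rpow hn']
        exact Real.log_le_log (Real.rpow_pos_of_pos hn' _) (hfar x (mem_sdiff.1 hx).2 a ha))
      (fun h0 => absurd (card_eq_zero.1 h0) hAne.ne_empty)
    have hlive : liveEdges A E id = E := by
      ext e
      rw [mem_liveEdges, Sym2.map_id, id, and_iff_left_iff_imp]
      exact hE e
    rw [hlive, himg] at hmain
    simp only [Sym2.map_id] at hmain
    simp only [id, sub_zero, zero_mul, add_zero] at hmain
    refine le_trans (le_of_eq ?_) (hmain.trans (le_of_eq ?_))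
    · rw [mul_sum, Real.exp_sum]
      refine prod_congr rfl fun e he => ?_
      have hp : 0 < pairDist (fun v => ((g v : ℕ) : ℝ)) e := by
        have := (hE e he).1
        induction e with | _ u v =>
        exact lt_of_lt_of_le one_pos (hone u v (by simpa using this))
      rw [pairDist_map]
      change pairDist (fun v => ((g v : ℕ) : ℝ)) e ^ (-α) = _
      rw [Real.rpow_def_of_pos hp, mul_comm]
    · congr 1
      rw [Real.rpow_def_of_pos hn', ← Real.exp_add]
      congr 1
      ring
  refine (sum_le_sum hpt).trans ?_
  rw [← mul_sum]
  refine mul_le_mul_of_nonneg_left ?_ (by positivity)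
  refine le_trans (sum_le_sum_of_subset_of_nonneg ?_ fun g _ _ => removalSum_nonneg _ _ _ _)
    (sum_removalSum_le A h _ univ rfl)
  classical exact filter_subset _ _

end Summation

/-! ### The probability of containing given edges -/

section Probability

open Finset

instance isProbabilityMeasure_edgeLaw (α : ℝ) (n : ℕ) : IsProbabilityMeasure (edgeLaw α n) := by
  unfold edgeLaw
  infer_instance

theorem edgeProbReal_le_rpow {α : ℝ} (hα : 0 ≤ α) {d : ℕ} (hd : 1 ≤ d) :
    edgeProbReal α d ≤ (d : ℝ) ^ (-α) := by
  unfold edgeProbReal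
  split_ifs with h
  · have : d = 1 := by omega
    subst this
    have : (1 : ℝ) ≤ (2 : ℝ) ^ α := Real.one_le_rpow (by norm_num) hα
    rw [Nat.cast_one, Real.one_rpow, div_le_one (by linarith)]
    exact this
  · rw [Real.rpow_neg (by positivity), one_div]

theorem bernoulliMeasure_edgeProb_le {α : ℝ} (hα : 0 ≤ α) {d : ℕ} (hd : 1 ≤ d) :
    bernoulliMeasure true false (edgeProb α d) {true} ≤ ENNReal.ofReal ((d : ℝ) ^ (-α)) := by
  have h : bernoulliMeasure true false (edgeProb α d) {true} =
      ENNReal.ofReal (edgeProb α d : ℝ) := by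
    rw [bernoulliMeasure_apply_of_mem_of_notMem _ (by simp) (by simp) (by simp)]
    rw [ENNReal.ofReal, ENNReal.coe_inj]
    ext
    simp [unitInterval.nonneg]
  rw [h, coe_edgeProb hα]
  exact ENNReal.ofReal_le_ofReal (edgeProbReal_le_rpow hα hd)

theorem drawnGraph_adj {n : ℕ} (ω : PointPair n → Bool) (q : PointPair n) :
    (drawnGraph ω).Adj q.1.1 q.1.2 ↔ ω q = true := by
  obtain ⟨⟨i, j⟩, hij⟩ := q
  simp only [drawnGraph, SimpleGraph.fromRel_adj]
  constructor
  · rintro ⟨-, ⟨_, h⟩ | ⟨h, _⟩⟩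
    · exact h
    · exact absurd hij h.asymm
  · exact fun h => ⟨ne_of_lt hij, Or.inl ⟨hij, h⟩⟩

theorem edgeLaw_forall_mem_edgeSet_le {α : ℝ} (hα : 0 ≤ α) {n : ℕ} (I : Finset (Sym2 (Fin n)))
    (hI : ∀ z ∈ I, ¬ z.IsDiag) :
    edgeLaw α n {ω | ∀ z ∈ I, z ∈ (drawnGraph ω).edgeSet} ≤
      ENNReal.ofReal (∏ z ∈ I, pairDist (fun i : Fin n => ((i : ℕ) : ℝ)) z ^ (-α)) := by
  classical
  let τ : PointPair n → Sym2 (Fin n) := fun q => s(q.1.1, q.1.2)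
  have hτ : Function.Injective τ := by
    rintro ⟨⟨i, j⟩, hij⟩ ⟨⟨i', j'⟩, hij'⟩ h
    rcases Sym2.eq_iff.1 h with ⟨rfl, rfl⟩ | ⟨rfl, rfl⟩
    · rfl
    · exact absurd hij hij'.asymm
  have hIτ : (univ.filter fun q => τ q ∈ I).image τ = I := by
    ext z
    simp only [mem_image, mem_filter, mem_univ, true_and]
    refine ⟨fun ⟨q, hq, h⟩ => h ▸ hq, fun hz => ?_⟩
    have hd := hI z hz
    induction z with | _ i j =>
    rcases lt_or_gt_of_ne (show i ≠ j by simpa using hd) with h | h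
    · exact ⟨⟨(i, j), h⟩, hz, rfl⟩
    · exact ⟨⟨(j, i), h⟩, by simpa [τ, Sym2.eq_swap] using hz, Sym2.eq_swap⟩
  have hsub : {ω : PointPair n → Bool | ∀ z ∈ I, z ∈ (drawnGraph ω).edgeSet} ⊆
      Set.univ.pi fun q => if τ q ∈ I then {true} else Set.univ := by
    intro ω hω q _
    dsimp only
    split_ifs with h
    · exact (drawnGraph_adj ω q).1 (hω _ h)
    · trivial
  refine (measure_mono hsub).trans ?_
  rw [edgeLaw, Measure.pi_pi]
  conv_rhs => rw [← hIτ, prod_image hτ.injOn]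
  rw [ENNReal.ofReal_prod_of_nonneg, prod_filter]
  · refine prod_le_prod' fun q _ => ?_
    split_ifs with h
    · have hq : (q.1.1 : ℕ) < q.1.2 := q.2
      refine (bernoulliMeasure_edgeProb_le hα (by omega)).trans (le_of_eq ?_)
      rw [pairDist_mk, Nat.cast_sub hq.le, abs_sub_comm, abs_of_nonneg]
      exact sub_nonneg.2 (by exact_mod_cast hq.le)
    · simp
  · intro q _
    exact Real.rpow_nonneg (abs_nonneg _) _

variable {W : Type*} [Fintype W] [DecidableEq W]

/-- The graph `M` has `k` injective copies of the edges in `E`, which agree on `A`, have no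
further common points, and keep the points outside `A` far from those in `A`. -/
def HasFarCopies (ε : ℝ) (k : ℕ) (A : Finset W) (E : Finset (Sym2 W)) {n : ℕ}
    (M : SimpleGraph (Fin n)) : Prop :=
  ∃ (h : W → Fin n) (g : Fin k → W → Fin n), (∀ l, g l ∈ farPlacements ε A h) ∧
    (∀ l l', l ≠ l' → ∀ x y, g l x = g l' y → x ∈ A) ∧
    ∀ l, ∀ e ∈ E, e.map (g l) ∈ M.edgeSet

theorem edgeLaw_copies_le {α ε : ℝ} (hα : 0 ≤ α) {A : Finset W} {E : Finset (Sym2 W)}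
    (hE : ∀ e ∈ E, IsLive A e) {n k : ℕ} {h : W → Fin n} {g : Fin k → W → Fin n}
    (hg : ∀ l, g l ∈ farPlacements ε A h)
    (hdisj : ∀ l l', l ≠ l' → ∀ x y, g l x = g l' y → x ∈ A) :
    edgeLaw α n {ω | ∀ l, ∀ e ∈ E, e.map (g l) ∈ (drawnGraph ω).edgeSet} ≤
      ENNReal.ofReal (∏ l, ∏ e ∈ E,
        pairDist (fun i : Fin n => ((i : ℕ) : ℝ)) (e.map (g l)) ^ (-α)) := by
  have hinj : ∀ l, Function.Injective (g l) := fun l => (mem_farPlacements.1 (hg l)).2.1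
  -- copies of edges under different placements are different pairs
  have hI : Set.InjOn (fun p : Fin k × Sym2 W => p.2.map (g p.1))
      (univ ×ˢ E : Finset (Fin k × Sym2 W)) := by
    rintro ⟨l, e⟩ he ⟨l', e'⟩ he' heq
    simp only [coe_product, Set.mem_prod, mem_coe] at he he' heq
    have hl : l = l' := by
      by_contra hne
      obtain ⟨-, v, hv, hvA⟩ := hE e he.2
      have hmem : g l v ∈ e.map (g l) := Sym2.mem_map.2 ⟨v, hv, rfl⟩
      rw [heq] at hmem
      obtain ⟨w, -, hw⟩ := Sym2.mem_map.1 hmem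
      exact hvA (hdisj l l' hne v w hw.symm)
    subst hl
    rw [Sym2.map.injective (hinj l) heq]
  have h1 := edgeLaw_forall_mem_edgeSet_le hα
    ((univ ×ˢ E : Finset (Fin k × Sym2 W)).image fun p => p.2.map (g p.1)) (by
      intro z hz
      obtain ⟨⟨l, e⟩, he, rfl⟩ := mem_image.1 hz
      have := (hE e (mem_product.1 he).2).1
      induction e with | _ u v =>
      simpa [(hinj l).eq_iff] using this)
  rw [prod_image hI, prod_product] at h1
  refine (measure_mono ?_).trans h1
  intro ω hω z hz
  obtain ⟨⟨l, e⟩, he, rfl⟩ := mem_image.1 hz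
  exact hω l e (mem_product.1 he).2

/-- The union bound over all placements; for disjoint copies the expectation factors. -/
theorem edgeLaw_hasFarCopies_le {α ε b : ℝ} (hα : 0 ≤ α) {A : Finset W} {E : Finset (Sym2 W)}
    (hE : ∀ e ∈ E, IsLive A e) {n k : ℕ}
    (hb : ∀ h : W → Fin n, ∑ g ∈ farPlacements ε A h,
      ∏ e ∈ E, pairDist (fun i : Fin n => ((i : ℕ) : ℝ)) (e.map g) ^ (-α) ≤ b) :
    edgeLaw α n {ω | HasFarCopies ε k A E (drawnGraph ω)} ≤
      ENNReal.ofReal ((n : ℝ) ^ Fintype.card W * b ^ k) := by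
  classical
  let F : (W → Fin n) → ℝ := fun g =>
    ∏ e ∈ E, pairDist (fun i : Fin n => ((i : ℕ) : ℝ)) (e.map g) ^ (-α)
  have hpd : ∀ z, 0 ≤ pairDist (fun i : Fin n => ((i : ℕ) : ℝ)) z := fun z => by
    induction z with | _ u v => exact abs_nonneg _
  have hF : ∀ g, 0 ≤ F g := fun g => prod_nonneg fun e _ => Real.rpow_nonneg (hpd _) _
  let T : (W → Fin n) → Finset (Fin k → W → Fin n) := fun h =>
    (Fintype.piFinset fun _ => farPlacements ε A h).filter fun g =>
      ∀ l l', l ≠ l' → ∀ x y, g l x = g l' y → x ∈ A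
  have hsub : {ω | HasFarCopies ε k A E (drawnGraph ω)} ⊆
      ⋃ h ∈ (univ : Finset (W → Fin n)), ⋃ g ∈ T h,
        {ω | ∀ l, ∀ e ∈ E, e.map (g l) ∈ (drawnGraph ω).edgeSet} := by
    rintro ω ⟨h, g, h1, h2, h3⟩
    simp only [Set.mem_iUnion]
    exact ⟨h, mem_univ _, g, mem_filter.2 ⟨Fintype.mem_piFinset.2 h1, h2⟩, h3⟩
  have hh : ∀ h ∈ (univ : Finset (W → Fin n)), edgeLaw α n (⋃ g ∈ T h,
      {ω | ∀ l, ∀ e ∈ E, e.map (g l) ∈ (drawnGraph ω).edgeSet}) ≤ ENNReal.ofReal (b ^ k) := by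
    intro h _
    have h0 : 0 ≤ ∑ g ∈ farPlacements ε A h, F g := sum_nonneg fun g _ => hF g
    calc _ ≤ ∑ g ∈ T h, edgeLaw α n {ω | ∀ l, ∀ e ∈ E,
            e.map (g l) ∈ (drawnGraph ω).edgeSet} := measure_biUnion_finset_le _ _
      _ ≤ ∑ g ∈ T h, ENNReal.ofReal (∏ l, F (g l)) := sum_le_sum fun g hg =>
          edgeLaw_copies_le hα hE (Fintype.mem_piFinset.1 (mem_filter.1 hg).1)
            (mem_filter.1 hg).2
      _ ≤ ∑ g ∈ Fintype.piFinset fun _ => farPlacements ε A h,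
            ENNReal.ofReal (∏ l, F (g l)) :=
          sum_le_sum_of_subset (filter_subset _ _)
      _ = ENNReal.ofReal ((∑ g ∈ farPlacements ε A h, F g) ^ k) := by
          rw [← ENNReal.ofReal_sum_of_nonneg fun g _ => prod_nonneg fun l _ => hF _,
            ← prod_univ_sum]
          simp
      _ ≤ ENNReal.ofReal (b ^ k) :=
          ENNReal.ofReal_le_ofReal (pow_le_pow_left₀ h0 (hb h) k)
  refine (measure_mono hsub).trans ((measure_biUnion_finset_le _ _).trans
    ((sum_le_card_nsmul _ _ _ hh).trans (le_of_eq ?_)))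
  rw [card_univ, Fintype.card_fun, Fintype.card_fin, nsmul_eq_mul,
    ENNReal.ofReal_mul (by positivity), ← Nat.cast_pow, ENNReal.ofReal_natCast]

theorem tendsto_one_add_log_pow_div (N : ℕ) :
    Tendsto (fun n : ℕ => (1 + Real.log n) ^ N / n) atTop (𝓝 0) := by
  have h1 : Tendsto (fun x : ℝ => Real.log x ^ N / x) atTop (𝓝 0) := by
    simpa using Real.isLittleO_pow_log_id_atTop.tendsto_div_nhds_zero
  have h2 : Tendsto (fun n : ℕ => Real.exp 1 * (n : ℝ)) atTop atTop :=
    tendsto_natCast_atTop_atTop.const_mul_atTop (Real.exp_pos 1)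
  have h3 := (h1.comp h2).const_mul (Real.exp 1)
  rw [mul_zero] at h3
  refine h3.congr' ?_
  filter_upwards [eventually_gt_atTop 0] with n hn
  have hn' : (0 : ℝ) < n := by exact_mod_cast hn
  have he := Real.exp_pos 1
  simp only [Function.comp]
  rw [Real.log_mul he.ne' hn'.ne', Real.log_exp]
  field_simp

theorem exists_tendsto_edgeLaw_hasFarCopies {A : Finset W} {E : Finset (Sym2 W)} {α c ε : ℝ}
    (hα : 0 ≤ α) (hc : 0 < c) (hε : 0 < ε) (hA : A.Nonempty) (hAne : (univ \ A).Nonempty)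
    (hE : ∀ e ∈ E, IsLive A e)
    (H : ∀ π : W → W, (∀ a ∈ A, π a = a) → (newClasses A π).Nonempty →
      ((newClasses A π).card : ℝ) + c ≤ α * (liveEdges A E π).card) :
    ∃ k : ℕ, 0 < k ∧
      Tendsto (fun n => edgeLaw α n {ω | HasFarCopies ε k A E (drawnGraph ω)}) atTop (𝓝 0) := by
  obtain ⟨m, hm⟩ : ∃ m, m = (univ \ A).card := ⟨_, rfl⟩
  obtain ⟨C, hC⟩ : ∃ C, C = Real.exp (α * E.card * Real.log 2 * m) *
    ((Fintype.card W : ℝ) ^ 2 * 2) ^ m := ⟨_, rfl⟩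
  obtain ⟨k, hk⟩ := exists_nat_gt (((Fintype.card W : ℝ) + 1) / (c * ε))
  have hcε := mul_pos hc hε
  have hkpos : (0 : ℝ) < k := lt_of_le_of_lt (by positivity) hk
  refine ⟨k, by exact_mod_cast hkpos, ?_⟩
  have hlim : Tendsto (fun n : ℕ => ENNReal.ofReal
      (C ^ k * ((1 + Real.log n) ^ (m * k) / n))) atTop (𝓝 0) := by
    have := ENNReal.tendsto_ofReal ((tendsto_one_add_log_pow_div (m * k)).const_mul (C ^ k))
    simpa using this
  refine tendsto_of_tendsto_of_tendsto_of_le_of_le' tendsto_const_nhds hlim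
    (Eventually.of_forall fun _ => zero_le) ?_
  filter_upwards [eventually_gt_atTop 0] with n hn
  have hn1 : (1 : ℝ) ≤ n := by exact_mod_cast hn
  have hn' : (0 : ℝ) < n := by linarith
  refine (edgeLaw_hasFarCopies_le hα hE fun h =>
    sum_prod_pairDist_rpow_le hα hc.le hA hAne hE H hn h).trans
      (ENNReal.ofReal_le_ofReal ?_)
  have hlog := Real.log_natCast_nonneg n
  rw [← hm]
  have hexp : (n : ℝ) ^ Fintype.card W * ((n : ℝ) ^ (-(c * ε))) ^ k ≤ 1 / n := by
    rw [← Real.rpow_natCast (n : ℝ), ← Real.rpow_natCast ((n : ℝ) ^ (-(c * ε))),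
      ← Real.rpow_mul hn'.le, ← Real.rpow_add hn', one_div, ← Real.rpow_neg_one]
    refine Real.rpow_le_rpow_of_exponent_le hn1 ?_
    rw [div_lt_iff₀ hcε] at hk
    nlinarith
  calc _ = C ^ k * (1 + Real.log n) ^ (m * k) *
        ((n : ℝ) ^ Fintype.card W * ((n : ℝ) ^ (-(c * ε))) ^ k) := by
        rw [hC, ← mul_assoc ((Fintype.card W : ℝ) ^ 2), mul_pow _ (1 + Real.log (n : ℝ)) m, pow_mul]
        ring
    _ ≤ C ^ k * (1 + Real.log n) ^ (m * k) * (1 / n) := by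
        refine mul_le_mul_of_nonneg_left hexp ?_
        have : 0 ≤ C := by rw [hC]; positivity
        positivity
    _ = _ := by ring

end Probability

/-! ### Weights of contractions -/

section Assembly

open Finset

variable {V : Type*}

/-- The points of `A`, as vertices of the induced subgraph on `B`. -/
noncomputable def oldPart (A B : Finset V) : Finset B :=
  open Classical in univ.filter fun w => (w : V) ∈ A

open Classical in
/-- The edges of `B` not contained in `A`. -/
noncomputable def newEdges (G : SimpleGraph V) (A B : Finset V) : Finset (Sym2 B) :=
  univ.filter fun e => e.map Subtype.val ∈ G.edgeSet ∧ ∃ v ∈ e, v ∉ oldPart A B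

@[simp]
theorem mem_oldPart {A B : Finset V} {w : B} : w ∈ oldPart A B ↔ (w : V) ∈ A := by
  simp [oldPart]

theorem mem_newEdges {G : SimpleGraph V} {A B : Finset V} {e : Sym2 B} :
    e ∈ newEdges G A B ↔ e.map Subtype.val ∈ G.edgeSet ∧ ∃ v ∈ e, v ∉ oldPart A B := by
  simp [newEdges]

/-- A map `π` fixing `A` gives an intermediate set `π ⁻¹' A` and, on the remaining points, the
equivalence relation of having the same image; the weight of this pair is negative. -/
theorem StarI.card_newClasses_lt [DecidableEq V] {α : ℝ} (hα : 0 ≤ α) {G : SimpleGraph V}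
    {A B : Finset V} (h : StarI α G A B) {π : B → B} (hπ : ∀ a ∈ oldPart A B, π a = a)
    (hne : (newClasses (oldPart A B) π).Nonempty) :
    ((newClasses (oldPart A B) π).card : ℝ) <
      α * (liveEdges (oldPart A B) (newEdges G A B) π).card := by
  classical
  let A' : Finset V := (univ.filter fun w : B => π w ∈ oldPart A B).map
    (Function.Embedding.subtype _)
  have hA' : ∀ w : B, (w : V) ∈ A' ↔ π w ∈ oldPart A B := by
    intro w
    simp [A']
  have hAA' : A ⊆ A' := fun a ha => by
    have hmem : (⟨a, h.1.1 ha⟩ : B) ∈ oldPart A B := mem_oldPart.2 ha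
    exact (hA' ⟨a, h.1.1 ha⟩).2 ((hπ _ hmem).symm ▸ hmem)
  have hA'B : A' ⊂ B := by
    refine (ssubset_iff_of_subset fun a ha => ?_).2 ?_
    · obtain ⟨w, -, rfl⟩ := mem_map.1 ha
      exact w.2
    · obtain ⟨z, hz⟩ := hne
      obtain ⟨hz1, hz2⟩ := mem_sdiff.1 hz
      obtain ⟨w, -, rfl⟩ := mem_image.1 hz1
      exact ⟨w, w.2, fun hw => hz2 ((hA' w).1 hw)⟩
  let F : NewVertex A' B → B := fun x => π ⟨x.1, x.2.1⟩
  have hw := (h.1.2 A' hAA' hA'B).2 (Setoid.ker F)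
  have hcount : classCount A' B (Setoid.ker F) = (newClasses (oldPart A B) π).card := by
    have hrange : Set.range F = (newClasses (oldPart A B) π : Set B) := by
      ext z
      simp only [newClasses, Set.mem_range, coe_sdiff, coe_image, coe_univ, Set.image_univ,
        Set.mem_sdiff, mem_coe]
      constructor
      · rintro ⟨x, rfl⟩
        exact ⟨⟨_, rfl⟩, fun hx => x.2.2 ((hA' ⟨x.1, x.2.1⟩).2 hx)⟩
      · rintro ⟨⟨w, rfl⟩, hw⟩
        exact ⟨⟨w, w.2, fun hx => hw ((hA' w).1 hx)⟩, rfl⟩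
    rw [classCount, Nat.card_congr (Setoid.quotientKerEquivRange F), hrange]
    simp
  have hlong : (longEdges G A' B (Setoid.ker F)).ncard ≤
      (liveEdges (oldPart A B) (newEdges G A B) π).card := by
    rw [← Set.ncard_coe_finset]
    refine le_trans (Set.ncard_le_ncard ?_ (Set.toFinite _))
      (Set.ncard_image_le (f := Sym2.map (Subtype.val : B → V)) (Set.toFinite _))
    intro e he
    induction e with | _ u v =>
    obtain ⟨hadj, hB, hnA, hcl⟩ := he
    have hu : u ∈ B := hB u (by simp)
    have hv : v ∈ B := hB v (by simp)
    refine ⟨s(⟨u, hu⟩, ⟨v, hv⟩), mem_liveEdges.2 ⟨mem_newEdges.2 ⟨hadj, ?_⟩, ?_, ?_⟩, rfl⟩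
    · by_contra hcon
      push Not at hcon
      refine hnA fun w hw => hAA' ?_
      rcases Sym2.mem_iff.1 hw with rfl | rfl
      · exact mem_oldPart.1 (hcon ⟨w, hu⟩ (by simp))
      · exact mem_oldPart.1 (hcon ⟨w, hv⟩ (by simp))
    · intro hdiag
      have hd : π ⟨u, hu⟩ = π ⟨v, hv⟩ := by simpa using hdiag
      have hiff : u ∈ A' ↔ v ∈ A' := by
        rw [hA' ⟨u, hu⟩, hA' ⟨v, hv⟩, hd]
      have huA : u ∉ A' := fun huA => hnA fun w hw => by
        rcases Sym2.mem_iff.1 hw with rfl | rfl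
        exacts [huA, hiff.1 huA]
      refine hcl ⟨u, hu, huA⟩ fun w hw => ?_
      rcases Sym2.mem_iff.1 hw with rfl | rfl
      · exact ⟨⟨hu, huA⟩, rfl⟩
      · exact ⟨⟨hv, fun h => huA (hiff.2 h)⟩, hd.symm⟩
    · by_contra hcon
      push Not at hcon
      refine hnA fun w hw => ?_
      rcases Sym2.mem_iff.1 hw with rfl | rfl
      · exact (hA' ⟨w, hu⟩).2 (hcon _ (by simp))
      · exact (hA' ⟨w, hv⟩).2 (hcon _ (by simp))
  rw [weight, hcount, sub_neg] at hw
  exact hw.trans_le (mul_le_mul_of_nonneg_left (by exact_mod_cast hlong) hα)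

/-- As there are finitely many maps `B → B`, the weights are bounded away from `0`. -/
theorem StarI.exists_card_newClasses_add_le [DecidableEq V] {α : ℝ} (hα : 0 ≤ α)
    {G : SimpleGraph V} {A B : Finset V} (h : StarI α G A B) :
    ∃ c : ℝ, 0 < c ∧ ∀ π : B → B, (∀ a ∈ oldPart A B, π a = a) →
      (newClasses (oldPart A B) π).Nonempty →
      ((newClasses (oldPart A B) π).card : ℝ) + c ≤
        α * (liveEdges (oldPart A B) (newEdges G A B) π).card := by
  classical
  let S : Finset (B → B) := univ.filter fun π => (∀ a ∈ oldPart A B, π a = a) ∧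
    (newClasses (oldPart A B) π).Nonempty
  rcases S.eq_empty_or_nonempty with hS | hS
  · refine ⟨1, one_pos, fun π h1 h2 => ?_⟩
    have : π ∈ S := mem_filter.2 ⟨mem_univ _, h1, h2⟩
    simp [hS] at this
  · obtain ⟨π₀, hπ₀, hmin⟩ := exists_min_image S (fun π =>
      α * (liveEdges (oldPart A B) (newEdges G A B) π).card -
        ((newClasses (oldPart A B) π).card : ℝ)) hS
    obtain ⟨-, h1, h2⟩ := mem_filter.1 hπ₀
    refine ⟨_, sub_pos.2 (h.card_newClasses_lt hα h1 h2), fun π h3 h4 => ?_⟩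
    have := hmin π (mem_filter.2 ⟨mem_univ _, h3, h4⟩)
    linarith

/-- The partition of `B` into a single class has no long edges if `A` is empty. -/
theorem StarI.nonempty {α : ℝ} {G : SimpleGraph V} {A B : Finset V} (hα : 0 ≤ α)
    (h : StarI α G A B) : A.Nonempty := by
  classical
  by_contra hA
  rw [not_nonempty_iff_eq_empty] at hA
  subst hA
  obtain ⟨b, hb⟩ := nonempty_iff_ne_empty.2 h.2.symm
  have hmem : (⟨b, hb⟩ : B) ∈ newClasses (oldPart ∅ B) fun _ => ⟨b, hb⟩ :=
    mem_sdiff.2 ⟨mem_image.2 ⟨⟨b, hb⟩, mem_univ _, rfl⟩, by simp⟩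
  have hlt := h.card_newClasses_lt hα (π := fun _ => ⟨b, hb⟩) (by simp) ⟨_, hmem⟩
  have hnone : liveEdges (oldPart ∅ B) (newEdges G ∅ B) (fun _ => ⟨b, hb⟩) = ∅ := by
    refine eq_empty_of_forall_notMem fun e he => ?_
    have hnd := (mem_liveEdges.1 he).2.1
    induction e with | _ u v => exact hnd (by simp)
  rw [hnone, card_empty, Nat.cast_zero, mul_zero] at hlt
  exact absurd hlt (Nat.cast_nonneg _).not_gt

theorem hasFarCopies_of_mem_farExtensions [DecidableEq V] {ε : ℝ} {k n : ℕ} (hk : 0 < k)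
    {G : SimpleGraph V} {A B B' : Finset V} (hAB' : A ⊆ B') (hB' : B' ⊆ B) {f : A → Fin n}
    {M : SimpleGraph (Fin n)} {g : Fin k → B → Fin n} (hg : g ∈ farExtensions ε k G A B f M) :
    HasFarCopies ε k (oldPart A B') (newEdges G A B') M := by
  obtain ⟨h1, h2, h3, h4⟩ := hg
  let j : B' → B := fun w => ⟨w, hB' w.2⟩
  have hj : Function.Injective j := fun u v huv => Subtype.ext (congrArg (fun x : B => (x : V)) huv)
  refine ⟨g ⟨0, hk⟩ ∘ j, fun l => g l ∘ j, fun l => mem_farPlacements.2 ⟨?_, ?_, ?_⟩, ?_, ?_⟩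
  · intro a ha
    have ha' : ((j a : B) : V) ∈ A := (mem_oldPart (B := B')).1 ha
    exact ((h1 l).2 (j a) ha').trans ((h1 _).2 (j a) ha').symm
  · exact (h1 l).1.comp hj
  · exact fun x hx a ha => h4 l (j x) (j a) (fun h => hx (mem_oldPart.2 h))
      ((mem_oldPart (B := B')).1 ha)
  · intro l l' hl x y hxy
    have hmem : g l (j x) ∈ Set.range f := by
      rw [← h3 l l' hl]
      exact ⟨⟨_, rfl⟩, ⟨j y, hxy.symm⟩⟩
    obtain ⟨a, ha⟩ := hmem
    have hx : j x = ⟨a, hB' (hAB' a.2)⟩ := (h1 l).1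
      (ha.symm.trans ((h1 l).2 ⟨a, hB' (hAB' a.2)⟩ a.2).symm)
    have : (x : V) = a := congrArg (fun x : B => (x : V)) hx
    exact mem_oldPart.2 (this ▸ a.2)
  · intro l e he
    obtain ⟨hadj, w, hw, hwA⟩ := mem_newEdges.1 he
    induction e with | _ u v =>
    refine h2 l (j u) (j v) hadj fun hcon => hwA (mem_oldPart.2 ?_)
    rcases Sym2.mem_iff.1 hw with rfl | rfl
    exacts [hcon.1, hcon.2]

end Assembly

theorem theorem2p4 (α : ℝ) (hα0 : 0 < α) (hα1 : α < 1) (hα : Irrational α)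
    {V : Type*} (G : SimpleGraph V) (A B : Finset V) (hAB : A ⊂ B)
    (ha : StarA α G A B) :
    ∀ ε : ℝ, 0 < ε → ∃ k : ℕ, ForRandomEnough α fun n M =>
      ∀ f : A → Fin n, Function.Injective f → farExtensions ε k G A B f M = ∅ := by
  classical
  intro ε hε
  obtain ⟨B', hI, hB'⟩ : ∃ B', StarI α G A B' ∧ B' ⊆ B := by
    by_contra hcon
    exact ha.2 ⟨⟨hAB.1, hcon⟩, hAB.ne⟩
  have hAB' : A ⊂ B' := hI.1.1.ssubset_of_ne hI.2
  obtain ⟨c, hc, H⟩ := hI.exists_card_newClasses_add_le hα0.le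
  have hA : (oldPart A B').Nonempty := by
    obtain ⟨a, ha⟩ := hI.nonempty hα0.le
    exact ⟨⟨a, hAB'.1 ha⟩, mem_oldPart.2 ha⟩
  have hnew : (Finset.univ \ oldPart A B').Nonempty := by
    obtain ⟨b, hb, hbA⟩ := Finset.exists_of_ssubset hAB'
    exact ⟨⟨b, hb⟩, by simp [hbA]⟩
  have hE : ∀ e ∈ newEdges G A B', IsLive (oldPart A B') e := by
    intro e he
    obtain ⟨hadj, hv⟩ := mem_newEdges.1 he
    refine ⟨fun hd => ?_, hv⟩
    induction e with | _ u v =>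
    obtain rfl : u = v := by simpa using hd
    exact G.loopless.irrefl _ hadj
  obtain ⟨k, hk, hlim⟩ := exists_tendsto_edgeLaw_hasFarCopies hα0.le hc hε hA hnew hE H
  refine ⟨k, ?_⟩
  have hlim' := ENNReal.Tendsto.sub (tendsto_const_nhds (x := (1 : ENNReal))) hlim
    (Or.inl ENNReal.one_ne_top)
  rw [tsub_zero] at hlim'
  refine tendsto_of_tendsto_of_tendsto_of_le_of_le hlim' tendsto_const_nhds (fun n => ?_)
    fun n => prob_le_one
  rw [tsub_le_iff_right, ← measure_univ (μ := edgeLaw α n)]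
  refine (measure_mono fun ω _ => ?_).trans (measure_union_le _ _)
  by_cases hω : HasFarCopies ε k (oldPart A B') (newEdges G A B') (drawnGraph ω)
  · exact Or.inr hω
  · exact Or.inl fun f _ => Set.eq_empty_of_forall_notMem fun g hg =>
      hω (hasFarCopies_of_mem_farExtensions hk hAB'.1 hB' hg)
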